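/- Let $G$ be a finite group and $\operatorname{Irr} G$ the set of its irreducible complex characters. For $X\subseteq \operatorname{Irr} G$ put $\sigma_X=\sum_{\chi\in X}\chi(1)\chi$, and for $K\subseteq G$ put $\hat K=\sum_{g\in K} g\in\mathbb{C}G$; extend characters linearly to $\mathbb{C}G$. For a set $\mathcal X$ of subsets of $\operatorname{Irr} G$ let $\operatorname{Clpt}(\mathcal X)$ be the partition of $G$ into the classes of the relation: $g\sim h$ if and only if $\sigma_X(g)=\sigma_X(h)$ for all $X\in\mathcal X$. For a set $\mathcal K$ of conjugation-invariant subsets of $G$ let $\operatorname{Irpt}(\mathcal K)$ be the partition of $\operatorname{Irr} G$ into the classes of the relation: $\chi\sim\psi$ if and only if $\chi(\hat K)/\chi(1)=\psi(\hat K)/\psi(1)$ for all $K\in\mathcal K$. A pair $(\mathcal X,\mathcal K)$ consisting of a partition $\mathcal X$ of $\operatorname{Irr} G$ and a partition $\mathcal K$ of $G$ is called a supercharacter theory of $G$ if $|\mathcal X|=|\mathcal K|$ and every $\sigma_X$ ($X\in\mathcal X$) is constant on every member of $\mathcal K$. Theorem. Let $\mathcal X$ be a partition of $\operatorname{Irr}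 G$ and let $\mathcal K$ be a partition of $G$ that is $G$-invariant (that is, every member of $\mathcal K$ is closed under conjugation by $G$). Then the following are equivalent: (a) $|\mathcal K|=|\mathcal X|$ and $\mathcal K=\operatorname{Clpt}(\mathcal X)$; (b) $|\mathcal K|=|\mathcal X|$ and $\mathcal X=\operatorname{Irpt}(\mathcal K)$; (c) $\mathcal K=\operatorname{Clpt}(\mathcal X)$ and $\mathcal X=\operatorname{Irpt}(\mathcal K)$; (d) the linear span in $\mathbb{C}G$ of the elements $\hat K$ ($K\in\mathcal K$) is a unital subalgebra of $\mathbf{Z}(\mathbb{C}G)$, and $\mathcal X=\operatorname{Irpt}(\mathcal K)$; (e) the linear span of the characters $\sigma_X$ ($X\in\mathcal X$) is a unital subalgebra of the algebra of all class functions on $G$ (with pointwise operations), and $\mathcal K=\operatorname{Clpt}(\mathcal X)$; (f) $(\mathcal X,\mathcal K)$ is a supercharacter theory of $G$. -/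

import Mathlib

noncomputable section

namespace Superchar

variable (G : Type*) [Group G]

/-- The irreducible complex characters of `G`, as functions on `G`. Every finite-dimensional
complex representation is isomorphic to one on some `ℂ ^ n`, so it is enough to take the traces
of irreducible representations on these spaces. -/
def Irr : Set (G → ℂ) :=
  {χ | ∃ (n : ℕ) (ρ : Representation ℂ G (Fin n → ℂ)), ρ.IsIrreducible ∧ χ = ρ.character}

variable {G}

open scoped Classical in
theorem Irr.orthogonal [Fintype G] (χ ψ : Irr G) :
    (Nat.card G : ℂ)⁻¹ * ∑ g : G, χ.1 g * ψ.1 g⁻¹ = if χ = ψ then 1 else 0 := by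
  obtain ⟨χ, n, ρ, hρ, rfl⟩ := χ
  obtain ⟨ψ, m, τ, hτ, rfl⟩ := ψ
  have : Invertible (Nat.card G : ℂ) := invertibleOfNonzero (by simp)
  by_cases h : ρ.character = τ.character
  · have := Representation.char_orthonormal ρ ρ
    rw [if_pos ⟨Representation.Equiv.refl _⟩] at this
    simpa [← h] using this
  · have := Representation.char_orthonormal ρ τ
    rw [if_neg (fun ⟨e⟩ => h (Representation.char_iso e).symm)] at this
    rw [this, if_neg (fun e => h (congrArg Subtype.val e))]

theorem Irr.linearIndependent [Finite G] :
    LinearIndependent ℂ (Subtype.val : Irr G → (G → ℂ)) := by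
  have := Fintype.ofFinite G
  rw [linearIndependent_iff']
  intro s c hc ψ hψ
  have h2 : ∑ χ ∈ s, c χ * ((Nat.card G : ℂ)⁻¹ * ∑ g : G, χ.1 g * ψ.1 g⁻¹) = 0 := by
    have h3 : ∀ g, ∑ χ ∈ s, c χ * χ.1 g = 0 := fun g => by
      simpa using congrFun hc g
    calc _ = (Nat.card G : ℂ)⁻¹ * ∑ g : G, (∑ χ ∈ s, c χ * χ.1 g) * ψ.1 g⁻¹ := by
          simp_rw [Finset.sum_mul, Finset.mul_sum]
          rw [Finset.sum_comm]
          refine Finset.sum_congr rfl fun _ _ => Finset.sum_congr rfl fun _ _ => by ring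
      _ = 0 := by simp [h3]
  classical
  simp_rw [Irr.orthogonal] at h2
  simpa [hψ] using h2

/-- A finite group has finitely many irreducible characters, so the sums below are finite. -/
instance [Finite G] : Finite (Irr G) :=
  LinearIndependent.finite_of_isNoetherian (Irr.linearIndependent (G := G))

/-- `σ_X = ∑_{χ ∈ X} χ(1) χ` for a set `X` of irreducible characters. -/
def sigma (X : Set (Irr G)) : G → ℂ :=
  fun g => ∑ᶠ χ ∈ X, χ.1 1 * χ.1 g

/-- `K̂ = ∑_{g ∈ K} g` in the group algebra. -/
def hat (K : Set G) : MonoidAlgebra ℂ G :=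
  ∑ᶠ g ∈ K, MonoidAlgebra.of ℂ G g

/-- The value `χ(z)` at an element `z` of the group algebra of the linear extension of a
function `χ` on the group. -/
def evalAlg (χ : G → ℂ) (z : MonoidAlgebra ℂ G) : ℂ :=
  z.coeff.sum fun g a => a * χ g

/-- The equivalence relation `g ∼ h` iff `σ_X(g) = σ_X(h)` for all `X ∈ 𝒳`. -/
def clSetoid (𝒳 : Set (Set (Irr G))) : Setoid G where
  r g h := ∀ X ∈ 𝒳, sigma X g = sigma X h
  iseqv := ⟨fun _ _ _ => rfl, fun h X hX => (h X hX).symm,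
    fun h h' X hX => (h X hX).trans (h' X hX)⟩

/-- The partition `Clpt(𝒳)` of `G`. -/
def Clpt (𝒳 : Set (Set (Irr G))) : Set (Set G) :=
  (clSetoid 𝒳).classes

/-- The equivalence relation `χ ∼ ψ` iff `χ(K̂) / χ(1) = ψ(K̂) / ψ(1)` for all `K ∈ 𝒦`. -/
def irrSetoid (𝒦 : Set (Set G)) : Setoid (Irr G) where
  r χ ψ := ∀ K ∈ 𝒦, evalAlg χ.1 (hat K) / χ.1 1 = evalAlg ψ.1 (hat K) / ψ.1 1
  iseqv := ⟨fun _ _ _ => rfl, fun h K hK => (h K hK).symm,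
    fun h h' K hK => (h K hK).trans (h' K hK)⟩

/-- The partition `Irpt(𝒦)` of `Irr G`. -/
def Irpt (𝒦 : Set (Set G)) : Set (Set (Irr G)) :=
  (irrSetoid 𝒦).classes

/-- A collection of subsets of `G` is `G`-invariant if all its members are closed under
conjugation. -/
def IsGInvariant (𝒦 : Set (Set G)) : Prop :=
  ∀ K ∈ 𝒦, ∀ g ∈ K, ∀ h : G, h * g * h⁻¹ ∈ K

variable (G) in
/-- The algebra of class functions on `G`, with pointwise operations. -/
def classFunctions : Subalgebra ℂ (G → ℂ) where
  carrier := {f | ∀ g h : G, f (h * g * h⁻¹) = f g}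
  mul_mem' ha hb g h := by simp [ha g h, hb g h]
  add_mem' ha hb g h := by simp [ha g h, hb g h]
  algebraMap_mem' _ _ _ := rfl

/-- The span of the `K̂`, `K ∈ 𝒦`, is a (unital) subalgebra of the center of `ℂG`. -/
def ClassSumsSpanSubalgebra (𝒦 : Set (Set G)) : Prop :=
  ∃ A : Subalgebra ℂ (MonoidAlgebra ℂ G),
    A ≤ Subalgebra.center ℂ (MonoidAlgebra ℂ G) ∧
      Subalgebra.toSubmodule A = Submodule.span ℂ (hat '' 𝒦)

/-- The span of the `σ_X`, `X ∈ 𝒳`, is a (unital) subalgebra of the algebra of class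
functions. -/
def CharSumsSpanSubalgebra (𝒳 : Set (Set (Irr G))) : Prop :=
  ∃ A : Subalgebra ℂ (G → ℂ),
    A ≤ classFunctions G ∧
      Subalgebra.toSubmodule A = Submodule.span ℂ (sigma '' 𝒳)

/-- `(𝒳, 𝒦)` is a supercharacter theory of `G`. -/
structure IsSupercharacterTheory (𝒳 : Set (Set (Irr G))) (𝒦 : Set (Set G)) : Prop where
  isPartition_irr : Setoid.IsPartition 𝒳
  isPartition_group : Setoid.IsPartition 𝒦
  card_eq : 𝒳.ncard = 𝒦.ncard
  constant : ∀ X ∈ 𝒳, ∀ K ∈ 𝒦, ∀ g ∈ K, ∀ h ∈ K, sigma X g = sigma X h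

end Superchar

end

/-! All six conditions are equivalent to one equality: the span of the `σ_X` is the whole algebra
`constOn 𝒦`. The injective map `charSum : a ↦ ∑ a(χ) χ(1) χ` carries `constOn 𝒳` onto the span of
the `σ_X`. By Fourier inversion on the center it carries the central character values of the `K̂` to
indicators of `K`, up to the factor `|G|` and inversion on `G`. Complex conjugation removes the
inversion, so the equality is self-dual: it also says that the functions `χ ↦ χ(K̂)/χ(1)` span
`constOn 𝒳` (`span_sigma_eq_iff_span_centralChar_eq`). The two spans have dimensions `|𝒳|` and
`|𝒦|`, so an inclusion plus equal cardinalities suffices. In the subalgebra conditions,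
`span_eq_constOn_classes` supplies the equality: a subalgebra of functions on a finite set is
determined by the points it separates. -/

namespace Superchar

/-! ### Function algebras of partitions. -/

section Partition

variable {α : Type*}

/-- The algebra of complex functions that are constant on every member of `P`. -/
def constOn (P : Set (Set α)) : Subalgebra ℂ (α → ℂ) where
  carrier := {f | ∀ S ∈ P, ∀ x ∈ S, ∀ y ∈ S, f x = f y}
  mul_mem' ha hb S hS x hx y hy := by simp [ha S hS x hx y hy, hb S hS x hx y hy]
  add_mem' ha hb S hS x hx y hy := by simp [ha S hS x hx y hy, hb S hS x hx y hy]
  algebraMap_mem' _ _ _ _ _ _ _ := rfl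

theorem mem_constOn_classes {r : Setoid α} {f : α → ℂ} :
    f ∈ constOn r.classes ↔ ∀ x y, r x y → f x = f y := by
  refine ⟨fun h x y hxy => h _ (r.mem_classes y) x hxy y (r.refl y), ?_⟩
  rintro h _ ⟨z, rfl⟩ x hx y hy
  exact h x y (r.trans hx (r.symm hy))

theorem eq_of_mem_partition {P : Set (Set α)} (hP : Setoid.IsPartition P) {S T : Set α} {x : α}
    (hS : S ∈ P) (hT : T ∈ P) (hxS : x ∈ S) (hxT : x ∈ T) : S = T :=
  (hP.2 x).unique ⟨hS, hxS⟩ ⟨hT, hxT⟩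

theorem indicator_mem_constOn {P : Set (Set α)} (hP : Setoid.IsPartition P) {S : Set α}
    (hS : S ∈ P) : S.indicator 1 ∈ constOn P := by
  classical
  intro T hT x hx y hy
  have key : ∀ z ∈ T, z ∈ S ↔ T = S := fun z hz =>
    ⟨fun h => eq_of_mem_partition hP hT hS hz h, fun h => h ▸ hz⟩
  simp [Set.indicator_apply, key x hx, key y hy]

theorem eq_sum_indicator {P : Set (Set α)} [Fintype P] (hP : Setoid.IsPartition P)
    (c : P → ℂ) {S : P} {x : α} (hx : x ∈ S.1) :
    (∑ T : P, c T • (T.1.indicator 1 : α → ℂ)) x = c S := by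
  classical
  rw [Finset.sum_apply, Finset.sum_eq_single S]
  · simp [hx]
  · intro T _ hT
    have : x ∉ T.1 := fun h => hT (Subtype.ext (eq_of_mem_partition hP T.2 S.2 h hx))
    simp [this]
  · simp

theorem span_indicator [Finite α] {P : Set (Set α)} (hP : Setoid.IsPartition P) :
    Submodule.span ℂ ((fun S : Set α => (S.indicator 1 : α → ℂ)) '' P) =
      Subalgebra.toSubmodule (constOn P) := by
  have := Fintype.ofFinite P
  apply le_antisymm
  · rw [Submodule.span_le]
    rintro _ ⟨S, hS, rfl⟩
    exact indicator_mem_constOn hP hS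
  · intro f hf
    have hf' : f = ∑ T : P,
        f (Setoid.nonempty_of_mem_partition hP T.2).some • (T.1.indicator 1 : α → ℂ) := by
      ext x
      obtain ⟨S, ⟨hS, hx⟩, -⟩ := hP.2 x
      rw [eq_sum_indicator hP (fun T : P => f (Setoid.nonempty_of_mem_partition hP T.2).some)
        (S := ⟨S, hS⟩) hx]
      exact hf S hS _ hx _ (Set.Nonempty.some_mem _)
    rw [hf']
    exact Submodule.sum_mem _ fun T _ => Submodule.smul_mem _ _
      (Submodule.subset_span ⟨T.1, T.2, rfl⟩)

theorem finrank_constOn [Finite α] {P : Set (Set α)} (hP : Setoid.IsPartition P) :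
    Module.finrank ℂ (Subalgebra.toSubmodule (constOn P)) = P.ncard := by
  have := Fintype.ofFinite P
  have hli : LinearIndependent ℂ (fun S : P => (S.1.indicator 1 : α → ℂ)) := by
    rw [Fintype.linearIndependent_iff]
    intro c hc S
    obtain ⟨x, hx⟩ := Setoid.nonempty_of_mem_partition hP S.2
    rw [← eq_sum_indicator hP c hx, hc]
    rfl
  rw [← span_indicator hP, Set.image_eq_range, finrank_span_eq_card hli, ← Nat.card_eq_fintype_card,
    Nat.card_coe_set_eq]

/-- The indicators of the blocks lie in the span of `F`, so `F` separates distinct blocks. -/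
theorem eq_classes_of_span_eq {P : Set (Set α)} (hP : Setoid.IsPartition P) {F : Set (α → ℂ)}
    {r : Setoid α} (hr : ∀ x y, r x y ↔ ∀ f ∈ F, f x = f y)
    (h : Submodule.span ℂ F = Subalgebra.toSubmodule (constOn P)) : P = r.classes := by
  classical
  rw [← Setoid.classes_mkClasses P hP]
  congr 1
  ext x y
  rw [hr]
  constructor
  · intro hxy f hf
    have hfP : f ∈ constOn P := by
      have : f ∈ Submodule.span ℂ F := Submodule.subset_span hf
      rwa [h] at this
    obtain ⟨S, ⟨hS, hx⟩, -⟩ := hP.2 x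
    exact hfP S hS x hx y (hxy S hS hx)
  · intro hxy S hS hx
    have hmem : (S.indicator 1 : α → ℂ) ∈ Submodule.span ℂ F := by
      rw [h]
      exact indicator_mem_constOn hP hS
    have : ∀ f ∈ Submodule.span ℂ F, f x = f y := fun f hf => by
      induction hf using Submodule.span_induction with
      | mem f hf => exact hxy f hf
      | zero => rfl
      | add f g _ _ hf hg => simp [hf, hg]
      | smul c f _ hf => simp [hf]
    by_contra hy
    simpa [hx, hy] using this _ hmem

theorem span_le_constOn_classes {F : Set (α → ℂ)}
    {r : Setoid α} (hr : ∀ x y, r x y ↔ ∀ f ∈ F, f x = f y) :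
    Submodule.span ℂ F ≤ Subalgebra.toSubmodule (constOn r.classes) := by
  rw [Submodule.span_le]
  intro f hf
  exact mem_constOn_classes.2 fun x y hxy => (hr x y).1 hxy f hf

/-- A subalgebra of the algebra of functions on a finite set consists of all functions that are
constant on the classes of points it does not separate. -/
theorem span_eq_constOn_classes [Finite α] {F : Set (α → ℂ)} {r : Setoid α}
    (hr : ∀ x y, r x y ↔ ∀ f ∈ F, f x = f y) {A : Subalgebra ℂ (α → ℂ)}
    (hA : Subalgebra.toSubmodule A = Submodule.span ℂ F) :
    Submodule.span ℂ F = Subalgebra.toSubmodule (constOn r.classes) := by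
  classical
  have := Fintype.ofFinite α
  apply le_antisymm (span_le_constOn_classes hr)
  rw [← span_indicator r.isPartition_classes, Submodule.span_le]
  rintro _ ⟨_, ⟨x, rfl⟩, rfl⟩
  have hFA : ∀ f ∈ F, f ∈ A := fun f hf => by
    have : f ∈ Submodule.span ℂ F := Submodule.subset_span hf
    rwa [← hA] at this
  have hsep : ∀ y, ¬ r y x → ∃ f ∈ F, f x ≠ f y := fun y hy => by
    rw [hr] at hy
    push Not at hy
    obtain ⟨f, hf, hne⟩ := hy
    exact ⟨f, hf, hne.symm⟩
  choose! s hsF hs using hsep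
  -- Lagrange interpolation: the factor for `y` vanishes at `y` and equals 1 on the class of `x`.
  let e : α → ℂ := ∏ y with ¬ r y x, (s y x - s y y)⁻¹ • (s y - algebraMap ℂ (α → ℂ) (s y y))
  have heA : e ∈ A := by
    refine Subalgebra.prod_mem _ fun y hy => Subalgebra.smul_mem _ (sub_mem ?_ ?_) _
    · exact hFA _ (hsF y (Finset.mem_filter.1 hy).2)
    · exact Subalgebra.algebraMap_mem _ _
  have he : e = Set.indicator {y | r y x} 1 := by
    ext y
    simp only [e, Finset.prod_apply]
    by_cases hy : r y x
    · rw [Set.indicator_of_mem (by exact hy)]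
      refine Finset.prod_eq_one fun z hz => ?_
      have hz' := (Finset.mem_filter.1 hz).2
      have h1 : s z y = s z x := (hr y x).1 hy _ (hsF z hz')
      simp only [Pi.smul_apply, Pi.sub_apply, Pi.algebraMap_apply, Algebra.algebraMap_self,
        RingHom.id_apply, smul_eq_mul, h1]
      exact inv_mul_cancel₀ (sub_ne_zero.2 (hs z hz'))
    · rw [Set.indicator_of_notMem (by exact hy)]
      exact Finset.prod_eq_zero (i := y) (by simpa using hy) (by simp)
  change Set.indicator {y | r y x} 1 ∈ Submodule.span ℂ F
  rw [← he, ← hA]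
  exact heA

end Partition

open scoped ComplexOrder Matrix

/-! ### Central characters, semisimplicity and character values at inverses. -/

section Representation

theorem evalAlg_eq_sum {α : Type*} [Fintype α] (χ : α → ℂ) (z : MonoidAlgebra ℂ α) :
    evalAlg χ z = ∑ g, z.coeff g * χ g :=
  Finsupp.sum_fintype _ _ fun _ => zero_mul _

variable {G : Type*} [Group G]

theorem mem_center_iff {z : MonoidAlgebra ℂ G} :
    z ∈ Subalgebra.center ℂ (MonoidAlgebra ℂ G) ↔
      ∀ g h : G, z.coeff (h * g * h⁻¹) = z.coeff g := by
  have key : ∀ h : G, MonoidAlgebra.of ℂ G h * z = z * MonoidAlgebra.of ℂ G h ↔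
      ∀ g, z.coeff (h⁻¹ * g) = z.coeff (g * h⁻¹) := fun h => by
    rw [← MonoidAlgebra.coeff_inj, Finsupp.ext_iff]
    simp [MonoidAlgebra.of_apply]
  rw [Subalgebra.mem_center_iff]
  constructor
  · intro hz g h
    have := (key h).1 (hz _) (h * g)
    rwa [inv_mul_cancel_left, eq_comm] at this
  · intro hz x
    induction x using MonoidAlgebra.induction_on with
    | of h =>
      refine (key h).2 fun g => ?_
      have := hz (h⁻¹ * g) h
      rwa [mul_inv_cancel_left, eq_comm] at this
    | add x y hx hy => rw [add_mul, mul_add, hx, hy]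
    | smul r x hx => rw [smul_mul_assoc, mul_smul_comm, hx]

theorem evalAlg_character {V : Type*} [AddCommGroup V] [Module ℂ V]
    (ρ : Representation ℂ G V) (z : MonoidAlgebra ℂ G) :
    evalAlg ρ.character z = LinearMap.trace ℂ V (ρ.asAlgebraHom z) := by
  rw [Representation.asAlgebraHom_def, MonoidAlgebra.lift_apply, evalAlg, Finsupp.sum, Finsupp.sum,
    map_sum]
  simp [Representation.character]

/-- Schur's lemma: a central element acts by an intertwining map. -/
theorem asAlgebraHom_eq_smul_one {V : Type*} [AddCommGroup V] [Module ℂ V] [FiniteDimensional ℂ V]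
    (ρ : Representation ℂ G V) (hρ : ρ.IsIrreducible) {z : MonoidAlgebra ℂ G}
    (hz : z ∈ Subalgebra.center ℂ (MonoidAlgebra ℂ G)) :
    ∃ c : ℂ, ρ.asAlgebraHom z = c • 1 := by
  let f : Representation.IntertwiningMap ρ ρ :=
    { toLinearMap := ρ.asAlgebraHom z
      isIntertwining' := fun g => by
        have := Subalgebra.mem_center_iff.1 hz (MonoidAlgebra.of ℂ G g)
        simpa [Module.End.mul_eq_comp] using (congrArg ρ.asAlgebraHom this).symm }
  obtain ⟨c, hc⟩ :=
    Representation.IsIrreducible.algebraMap_intertwiningMap_bijective_of_isAlgClosed.2 f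
  refine ⟨c, ?_⟩
  have := congrArg Representation.IntertwiningMap.toLinearMap hc
  exact this.symm

theorem pos_of_isIrreducible {n : ℕ} {ρ : Representation ℂ G (Fin n → ℂ)}
    (hρ : ρ.IsIrreducible) : 0 < n := by
  rcases Nat.eq_zero_or_pos n with rfl | h
  · have : Nontrivial ρ.asModule := IsSimpleModule.nontrivial (MonoidAlgebra ℂ G) ρ.asModule
    exact absurd (inferInstanceAs (Subsingleton (Fin 0 → ℂ)))
      (not_subsingleton_iff_nontrivial.2 this)
  · exact h

theorem Irr.apply_one_ne_zero (χ : Irr G) : χ.1 1 ≠ 0 := by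
  obtain ⟨_, n, ρ, hρ, rfl⟩ := χ
  simpa using (pos_of_isIrreducible hρ).ne'

theorem Irr.apply_conj (χ : Irr G) (g h : G) : χ.1 (h * g * h⁻¹) = χ.1 g := by
  obtain ⟨_, n, ρ, hρ, rfl⟩ := χ
  exact ρ.char_conj g h

/-- The central character attached to `χ`. -/
noncomputable def centralChar : MonoidAlgebra ℂ G →ₗ[ℂ] (Irr G → ℂ) where
  toFun z χ := evalAlg χ.1 z / χ.1 1
  map_add' z w := by
    ext χ
    obtain ⟨_, n, ρ, hρ, rfl⟩ := χ
    simp [evalAlg_character, add_div]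
  map_smul' c z := by
    ext χ
    obtain ⟨_, n, ρ, hρ, rfl⟩ := χ
    simp [evalAlg_character, mul_div_assoc]

theorem centralChar_apply (z : MonoidAlgebra ℂ G) (χ : Irr G) :
    centralChar z χ = evalAlg χ.1 z / χ.1 1 := rfl

theorem asAlgebraHom_of_mem_center {n : ℕ} (ρ : Representation ℂ G (Fin n → ℂ))
    (hρ : ρ.IsIrreducible) {z : MonoidAlgebra ℂ G}
    (hz : z ∈ Subalgebra.center ℂ (MonoidAlgebra ℂ G)) :
    ρ.asAlgebraHom z = centralChar z ⟨ρ.character, n, ρ, hρ, rfl⟩ • 1 := by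
  obtain ⟨c, hc⟩ := asAlgebraHom_eq_smul_one ρ hρ hz
  have hn : (n : ℂ) ≠ 0 := by simpa using (pos_of_isIrreducible hρ).ne'
  rw [centralChar_apply, evalAlg_character, hc]
  simp [hn]

theorem centralChar_mul {z : MonoidAlgebra ℂ G}
    (hz : z ∈ Subalgebra.center ℂ (MonoidAlgebra ℂ G)) (w : MonoidAlgebra ℂ G) :
    centralChar (z * w) = centralChar z * centralChar w := by
  ext χ
  obtain ⟨_, n, ρ, hρ, rfl⟩ := χ
  rw [Pi.mul_apply, centralChar_apply (z * w), centralChar_apply w, evalAlg_character,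
    evalAlg_character, map_mul, asAlgebraHom_of_mem_center ρ hρ hz, smul_mul_assoc, one_mul,
    map_smul, smul_eq_mul, mul_div_assoc]

theorem centralChar_one : centralChar (1 : MonoidAlgebra ℂ G) = 1 := by
  ext χ
  have hχ := Irr.apply_one_ne_zero χ
  obtain ⟨_, n, ρ, hρ, rfl⟩ := χ
  rw [centralChar_apply, evalAlg_character, map_one, ← map_one ρ]
  exact div_self hχ

variable [Finite G]

/-- By Maschke the Jacobson radical vanishes, so it is enough that `z` lies in every maximal left
ideal `m`. It does, because `z` kills the class of 1 in the simple module `ℂG ⧸ m`. -/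
theorem eq_zero_of_asAlgebraHom_eq_zero {z : MonoidAlgebra ℂ G}
    (hz : ∀ (n : ℕ) (ρ : Representation ℂ G (Fin n → ℂ)), ρ.IsIrreducible →
      ρ.asAlgebraHom z = 0) : z = 0 := by
  have hJ : Ring.jacobson (MonoidAlgebra ℂ G) = ⊥ := IsSemisimpleRing.jacobson_eq_bot _
  rw [← Submodule.mem_bot (MonoidAlgebra ℂ G), ← hJ, Ring.jacobson, Module.jacobson,
    Submodule.mem_sInf]
  intro m hm
  have : IsSimpleModule (MonoidAlgebra ℂ G) (MonoidAlgebra ℂ G ⧸ m) :=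
    isSimpleModule_iff_isCoatom.2 hm
  have : Module.Finite ℂ (MonoidAlgebra ℂ G) := inferInstance
  have : Module.Finite ℂ (MonoidAlgebra ℂ G ⧸ m) :=
    Module.Finite.trans (MonoidAlgebra ℂ G) _
  -- Coordinates move the simple quotient to some `Fin n → ℂ`, where the hypothesis applies.
  let e := (Module.finBasis ℂ (MonoidAlgebra ℂ G ⧸ m)).equivFun
  let F : MonoidAlgebra ℂ G →ₐ[ℂ] Module.End ℂ _ :=
    (e.conjAlgEquiv ℂ).toAlgHom.comp (Algebra.lsmul ℂ ℂ (MonoidAlgebra ℂ G ⧸ m))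
  let ρ : Representation ℂ G _ := (MonoidAlgebra.lift ℂ _ G).symm F
  have hρF : ρ.asAlgebraHom = F := Equiv.apply_symm_apply _ _
  have hF : ∀ x v, F x v = e (x • e.symm v) := fun x v => rfl
  let e' : ρ.asModule ≃ₗ[MonoidAlgebra ℂ G] (MonoidAlgebra ℂ G ⧸ m) :=
    { toFun := fun v => e.symm (ρ.asModuleEquiv v)
      invFun := fun v => ρ.asModuleEquiv.symm (e v)
      left_inv := fun v => by simp
      right_inv := fun v => by simp
      map_add' := fun v w => by simp
      map_smul' := fun x v => by
        rw [Representation.asModuleEquiv_map_smul, hρF, hF, e.symm_apply_apply]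
        rfl }
  have hρ : ρ.IsIrreducible :=
    (Representation.irreducible_iff_isSimpleModule_asModule ρ).2 (IsSimpleModule.congr e')
  have h0 := hz _ ρ hρ
  rw [hρF] at h0
  have h1 : e (z • e.symm (e (Submodule.Quotient.mk 1))) = 0 := by
    rw [← hF, h0]
    rfl
  rw [e.symm_apply_apply, map_eq_zero_iff e e.injective, ← Submodule.Quotient.mk_smul, smul_eq_mul,
    mul_one, Submodule.Quotient.mk_eq_zero] at h1
  exact h1

theorem eq_zero_of_centralChar_eq_zero {z : MonoidAlgebra ℂ G}
    (hz : z ∈ Subalgebra.center ℂ (MonoidAlgebra ℂ G)) (h : centralChar z = 0) : z = 0 :=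
  eq_zero_of_asAlgebraHom_eq_zero fun n ρ hρ => by
    rw [asAlgebraHom_of_mem_center ρ hρ hz, h, Pi.zero_apply, zero_smul]

/-- Unitarian trick: the positive definite form `H = ∑ M(g)ᴴ M(g)` is invariant, so `M(g)ᴴ` is
similar to `M(g⁻¹)` and has the same trace. -/
theorem Irr.apply_inv (χ : Irr G) (g : G) : χ.1 g⁻¹ = star (χ.1 g) := by
  have := Fintype.ofFinite G
  obtain ⟨_, n, ρ, hρ, rfl⟩ := χ
  let M : G → Matrix (Fin n) (Fin n) ℂ := fun g => LinearMap.toMatrix' (ρ g)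
  have hM : ∀ g h, M (g * h) = M g * M h := fun g h => by
    simp only [M, map_mul, LinearMap.toMatrix'_mul]
  have hM1 : M 1 = 1 := by simp [M]
  have htr : ∀ g, ρ.character g = (M g).trace := fun g => by
    rw [Representation.character, LinearMap.trace_eq_matrix_trace ℂ (Pi.basisFun ℂ (Fin n))]
    rfl
  let H := ∑ g, (M g)ᴴ * M g
  have hH : H.PosDef := by
    classical
    rw [show H = (M 1)ᴴ * M 1 + ∑ g ∈ Finset.univ.erase 1, (M g)ᴴ * M g from
      (Finset.add_sum_erase _ _ (Finset.mem_univ 1)).symm]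
    refine Matrix.PosDef.add_posSemidef ?_
      (Matrix.posSemidef_sum _ fun g _ => Matrix.posSemidef_conjTranspose_mul_self _)
    rw [hM1, Matrix.conjTranspose_one, one_mul]
    exact Matrix.PosDef.one
  have hinv : (M g)ᴴ * H * M g = H := by
    simp only [H, Finset.mul_sum, Finset.sum_mul]
    refine Fintype.sum_equiv (Equiv.mulRight g) _ _ fun h => ?_
    simp only [Equiv.coe_mulRight, hM, Matrix.conjTranspose_mul, mul_assoc]
  have hcomm : (M g)ᴴ * H = H * M g⁻¹ := by
    conv_rhs => rw [← hinv, mul_assoc, ← hM, mul_inv_cancel, hM1, mul_one]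
  have hdet : IsUnit H.det := (Matrix.isUnit_iff_isUnit_det H).1 hH.isUnit
  change ρ.character g⁻¹ = star (ρ.character g)
  rw [htr, htr, ← Matrix.trace_conjTranspose]
  rw [show (M g)ᴴ = H * (M g⁻¹ * H⁻¹) by
    rw [← mul_assoc, ← hcomm, mul_assoc, Matrix.mul_nonsing_inv _ hdet, mul_one]]
  rw [Matrix.trace_mul_comm, mul_assoc, Matrix.nonsing_inv_mul _ hdet, mul_one]

end Representation

/-! ### Fourier duality between the two partitions. -/

section Duality

variable {G : Type*} [Group G]

/-- Precomposition with inversion. -/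
def compInv : (G → ℂ) ≃ₗ[ℂ] (G → ℂ) := LinearEquiv.funCongrLeft ℂ ℂ (Equiv.inv G)

theorem compInv_apply (f : G → ℂ) (g : G) : compInv f g = f g⁻¹ := rfl

theorem compInv_compInv (f : G → ℂ) : compInv (compInv f) = f := by
  ext g
  simp [compInv_apply]

variable [Finite G]

/-- The linear map sending coefficients `a` to the class function `∑ χ, a χ * χ(1) * χ`. -/
noncomputable def charSum : (Irr G → ℂ) →ₗ[ℂ] (G → ℂ) where
  toFun a := ∑ᶠ χ : Irr G, (a χ * χ.1 1) • χ.1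
  map_add' a b := by
    have := Fintype.ofFinite (Irr G)
    simp [finsum_eq_sum_of_fintype, add_mul, add_smul, Finset.sum_add_distrib]
  map_smul' c a := by
    have := Fintype.ofFinite (Irr G)
    simp [finsum_eq_sum_of_fintype, mul_assoc, mul_smul, Finset.smul_sum]

theorem charSum_eq_sum [Fintype (Irr G)] (a : Irr G → ℂ) :
    charSum a = ∑ χ : Irr G, (a χ * χ.1 1) • χ.1 :=
  finsum_eq_sum_of_fintype _

theorem charSum_apply [Fintype (Irr G)] (a : Irr G → ℂ) (g : G) :
    charSum a g = ∑ χ : Irr G, a χ * χ.1 1 * χ.1 g := by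
  simp [charSum_eq_sum, Finset.sum_apply]

theorem charSum_injective : Function.Injective (charSum (G := G)) := by
  have := Fintype.ofFinite (Irr G)
  rw [injective_iff_map_eq_zero]
  intro a ha
  rw [charSum_eq_sum] at ha
  ext χ
  have := Fintype.linearIndependent_iff.1 Irr.linearIndependent _ ha χ
  exact (mul_eq_zero.1 this).resolve_right (Irr.apply_one_ne_zero χ)

theorem charSum_indicator (X : Set (Irr G)) : charSum (X.indicator 1) = sigma X := by
  classical
  have := Fintype.ofFinite (Irr G)
  ext g
  rw [charSum_apply, sigma, finsum_mem_eq_finite_toFinset_sum _ X.toFinite]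
  simp [Set.indicator_apply, ← Finset.sum_filter]
  refine Finset.sum_congr ?_ fun _ _ => rfl
  ext; simp

theorem sum_charSum_mul_inv [Fintype G] (a : Irr G → ℂ) (ψ : Irr G) :
    ∑ g, charSum a g * ψ.1 g⁻¹ = Nat.card G * (a ψ * ψ.1 1) := by
  classical
  have := Fintype.ofFinite (Irr G)
  have hG : (Nat.card G : ℂ) ≠ 0 := Nat.cast_ne_zero.2 Nat.card_pos.ne'
  have horth : ∀ χ : Irr G, ∑ g, χ.1 g * ψ.1 g⁻¹ = Nat.card G * if χ = ψ then 1 else 0 :=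
    fun χ => by rw [← Irr.orthogonal, mul_inv_cancel_left₀ hG]
  calc ∑ g, charSum a g * ψ.1 g⁻¹ = ∑ χ : Irr G, a χ * χ.1 1 * ∑ g, χ.1 g * ψ.1 g⁻¹ := by
        simp_rw [charSum_apply, Finset.sum_mul, Finset.mul_sum]
        rw [Finset.sum_comm]
        simp_rw [mul_assoc]
    _ = _ := by
        simp_rw [horth]
        simp [mul_comm]

/-- Fourier inversion for the center of the group algebra. -/
theorem charSum_centralChar {z : MonoidAlgebra ℂ G}
    (hz : z ∈ Subalgebra.center ℂ (MonoidAlgebra ℂ G)) (g : G) :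
    charSum (centralChar z) g = Nat.card G * z.coeff g⁻¹ := by
  have := Fintype.ofFinite G
  have := Fintype.ofFinite (Irr G)
  -- Both `w` and `|G| z` are central; orthogonality gives them the same central character, so they
  -- coincide.
  let w : MonoidAlgebra ℂ G :=
    .ofCoeff (Finsupp.equivFunOnFinite.symm fun g => charSum (centralChar z) g⁻¹)
  have hw : ∀ g, w.coeff g = charSum (centralChar z) g⁻¹ := fun g => rfl
  have hwc : w ∈ Subalgebra.center ℂ (MonoidAlgebra ℂ G) := mem_center_iff.2 fun g h => by
    rw [hw, hw, charSum_apply, charSum_apply]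
    refine Finset.sum_congr rfl fun χ _ => ?_
    rw [← Irr.apply_conj χ g⁻¹ h]
    simp [mul_assoc]
  have h0 : w - (Nat.card G : ℂ) • z = 0 := by
    refine eq_zero_of_centralChar_eq_zero (sub_mem hwc (Subalgebra.smul_mem _ hz _)) ?_
    rw [map_sub, map_smul, sub_eq_zero]
    ext χ
    have hχ := Irr.apply_one_ne_zero χ
    have : evalAlg χ.1 w = Nat.card G * (centralChar z χ * χ.1 1) := by
      rw [← sum_charSum_mul_inv, evalAlg_eq_sum]
      exact Fintype.sum_equiv (Equiv.inv G) _ _ fun h => by simp [hw]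
    rw [centralChar_apply w, this, Pi.smul_apply, smul_eq_mul]
    field_simp
  have h1 := congrArg (fun x : MonoidAlgebra ℂ G => x.coeff g⁻¹) h0
  simpa [hw, sub_eq_zero] using h1

theorem coeff_hat (K : Set G) (g : G) : (hat K).coeff g = K.indicator 1 g := by
  classical
  rw [hat, finsum_mem_eq_finite_toFinset_sum _ K.toFinite, MonoidAlgebra.coeff_sum,
    Finsupp.finsetSum_apply]
  simp [MonoidAlgebra.of_apply, Finsupp.single_apply, Set.indicator_apply]

theorem hat_mem_center {𝒦 : Set (Set G)} (hinv : IsGInvariant 𝒦) {K : Set G} (hK : K ∈ 𝒦) :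
    hat K ∈ Subalgebra.center ℂ (MonoidAlgebra ℂ G) := by
  classical
  refine mem_center_iff.2 fun g h => ?_
  have key : h * g * h⁻¹ ∈ K ↔ g ∈ K :=
    ⟨fun hg => by simpa [mul_assoc] using hinv K hK _ hg h⁻¹, fun hg => hinv K hK g hg h⟩
  simp [coeff_hat, Set.indicator_apply, key]

theorem charSum_centralChar_hat {𝒦 : Set (Set G)} (hinv : IsGInvariant 𝒦) {K : Set G}
    (hK : K ∈ 𝒦) :
    charSum (centralChar (hat K)) = (Nat.card G : ℂ) • compInv (K.indicator 1) := by
  ext g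
  rw [charSum_centralChar (hat_mem_center hinv hK), coeff_hat]
  rfl

variable {𝒳 : Set (Set (Irr G))} {𝒦 : Set (Set G)}

theorem map_charSum_constOn (h𝒳 : Setoid.IsPartition 𝒳) :
    (Subalgebra.toSubmodule (constOn 𝒳)).map charSum = Submodule.span ℂ (sigma '' 𝒳) := by
  rw [← span_indicator h𝒳, Submodule.map_span, Set.image_image]
  simp_rw [charSum_indicator]

theorem map_charSum_span_centralChar (h𝒦 : Setoid.IsPartition 𝒦) (hinv : IsGInvariant 𝒦) :
    (Submodule.span ℂ ((fun K => centralChar (hat K)) '' 𝒦)).map charSum =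
      (Subalgebra.toSubmodule (constOn 𝒦)).map compInv.toLinearMap := by
  have hG : (Nat.card G : ℂ) ≠ 0 := Nat.cast_ne_zero.2 Nat.card_pos.ne'
  rw [← span_indicator h𝒦, Submodule.map_span, Submodule.map_span, Set.image_image,
    Set.image_image]
  apply le_antisymm <;> rw [Submodule.span_le]
  · rintro _ ⟨K, hK, rfl⟩
    dsimp only
    rw [charSum_centralChar_hat hinv hK]
    exact Submodule.smul_mem _ _ (Submodule.subset_span ⟨K, hK, rfl⟩)
  · rintro _ ⟨K, hK, rfl⟩
    have : compInv (K.indicator 1) =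
        (Nat.card G : ℂ)⁻¹ • charSum (centralChar (hat K)) := by
      rw [charSum_centralChar_hat hinv hK, inv_smul_smul₀ hG]
    dsimp only
    rw [LinearEquiv.coe_coe, this]
    exact Submodule.smul_mem _ _ (Submodule.subset_span ⟨K, hK, rfl⟩)

theorem finrank_span_sigma (h𝒳 : Setoid.IsPartition 𝒳) :
    Module.finrank ℂ (Submodule.span ℂ (sigma '' 𝒳)) = 𝒳.ncard := by
  rw [← map_charSum_constOn h𝒳, ← finrank_constOn h𝒳]
  exact (LinearEquiv.finrank_eq (Submodule.equivMapOfInjective _ charSum_injective _)).symm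

theorem finrank_span_centralChar (h𝒦 : Setoid.IsPartition 𝒦) (hinv : IsGInvariant 𝒦) :
    Module.finrank ℂ (Submodule.span ℂ ((fun K => centralChar (hat K)) '' 𝒦)) = 𝒦.ncard := by
  rw [← finrank_constOn h𝒦,
    LinearEquiv.finrank_eq (Submodule.equivMapOfInjective _ charSum_injective _),
    map_charSum_span_centralChar h𝒦 hinv]
  exact LinearEquiv.finrank_map_eq compInv _

theorem compInv_sigma (X : Set (Irr G)) : compInv (sigma X) = star (sigma X) := by
  ext g
  rw [compInv_apply, Pi.star_apply, sigma, finsum_mem_eq_finite_toFinset_sum _ X.toFinite,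
    sigma, finsum_mem_eq_finite_toFinset_sum _ X.toFinite, star_sum]
  refine Finset.sum_congr rfl fun χ _ => ?_
  rw [star_mul', ← Irr.apply_inv, ← Irr.apply_inv, inv_one]

theorem star_compInv_mem {f : G → ℂ} (hf : f ∈ Submodule.span ℂ (sigma '' 𝒳)) :
    star (compInv f) ∈ Submodule.span ℂ (sigma '' 𝒳) := by
  induction hf using Submodule.span_induction with
  | mem f hf =>
    obtain ⟨X, hX, rfl⟩ := hf
    rw [compInv_sigma, star_star]
    exact Submodule.subset_span ⟨X, hX, rfl⟩
  | zero => simp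
  | add f g _ _ hf hg => simpa using add_mem hf hg
  | smul c f _ hf => simpa using Submodule.smul_mem _ (star c) hf

theorem star_mem_constOn {α : Type*} {P : Set (Set α)} {f : α → ℂ} (hf : f ∈ constOn P) :
    star f ∈ constOn P := fun S hS x hx y hy => congrArg star (hf S hS x hx y hy)

/-- The span of the `σ_X` is stable under `f ↦ star (compInv f)`. Either equality makes it stable
under `star` as well, hence under `compInv`. -/
theorem span_sigma_eq_map_compInv_iff :
    Submodule.span ℂ (sigma '' 𝒳) =
        (Subalgebra.toSubmodule (constOn 𝒦)).map compInv.toLinearMap ↔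
      Submodule.span ℂ (sigma '' 𝒳) = Subalgebra.toSubmodule (constOn 𝒦) := by
  have hmap : ∀ f : G → ℂ, f ∈ (Subalgebra.toSubmodule (constOn 𝒦)).map compInv.toLinearMap ↔
      compInv f ∈ constOn 𝒦 := fun f => by
    constructor
    · rintro ⟨g, hg, rfl⟩
      simpa [compInv_compInv] using hg
    · exact fun h => ⟨_, h, compInv_compInv f⟩
  simp only [SetLike.ext_iff, hmap, Subalgebra.mem_toSubmodule]
  have hinv : (∀ f : G → ℂ, f ∈ Submodule.span ℂ (sigma '' 𝒳) →
      star f ∈ Submodule.span ℂ (sigma '' 𝒳)) → ∀ f : G → ℂ,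
      compInv f ∈ Submodule.span ℂ (sigma '' 𝒳) ↔ f ∈ Submodule.span ℂ (sigma '' 𝒳) := by
    intro hstar
    have h1 : ∀ f : G → ℂ, f ∈ Submodule.span ℂ (sigma '' 𝒳) →
        compInv f ∈ Submodule.span ℂ (sigma '' 𝒳) := fun f hf => by
      simpa using hstar _ (star_compInv_mem hf)
    exact fun f => ⟨fun hf => compInv_compInv f ▸ h1 _ hf, h1 f⟩
  constructor
  · intro h f
    rw [← hinv (fun f hf => (h _).2 (star_mem_constOn ((h f).1 hf))), h, compInv_compInv]
  · intro h f
    rw [← hinv (fun f hf => (h _).2 (star_mem_constOn ((h f).1 hf))), h]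

/-- The duality between the two sides of a supercharacter theory. -/
theorem span_sigma_eq_iff_span_centralChar_eq (h𝒳 : Setoid.IsPartition 𝒳)
    (h𝒦 : Setoid.IsPartition 𝒦) (hinv : IsGInvariant 𝒦) :
    Submodule.span ℂ (sigma '' 𝒳) = Subalgebra.toSubmodule (constOn 𝒦) ↔
      Submodule.span ℂ ((fun K => centralChar (hat K)) '' 𝒦) =
        Subalgebra.toSubmodule (constOn 𝒳) := by
  rw [← (Submodule.map_injective_of_injective charSum_injective).eq_iff, map_charSum_constOn h𝒳,
    map_charSum_span_centralChar h𝒦 hinv, eq_comm (b := Submodule.span ℂ (sigma '' 𝒳)),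
    span_sigma_eq_map_compInv_iff]

end Duality

/-! ### The subalgebra conditions and the equivalence. -/

section Main

variable {G : Type*} [Group G] {𝒳 : Set (Set (Irr G))} {𝒦 : Set (Set G)}

theorem clSetoid_iff (g h : G) :
    clSetoid 𝒳 g h ↔ ∀ f ∈ sigma '' 𝒳, f g = f h := by
  rw [Set.forall_mem_image]
  rfl

theorem irrSetoid_iff (χ ψ : Irr G) :
    irrSetoid 𝒦 χ ψ ↔ ∀ f ∈ (fun K => centralChar (hat K)) '' 𝒦, f χ = f ψ := by
  rw [Set.forall_mem_image]
  rfl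

theorem constOn_le_classFunctions (h𝒦 : Setoid.IsPartition 𝒦) (hinv : IsGInvariant 𝒦) :
    constOn 𝒦 ≤ classFunctions G := by
  intro f hf g h
  obtain ⟨K, ⟨hK, hg⟩, -⟩ := h𝒦.2 g
  exact hf K hK _ (hinv K hK g hg h) g hg

variable [Finite G]

/-- On the center `centralChar` is an injective algebra homomorphism, so the span of the `K̂` is the
preimage there of the algebra `constOn 𝒳`. -/
theorem classSumsSpanSubalgebra_of_span_eq (hinv : IsGInvariant 𝒦)
    (h : Submodule.span ℂ ((fun K => centralChar (hat K)) '' 𝒦) =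
      Subalgebra.toSubmodule (constOn 𝒳)) : ClassSumsSpanSubalgebra 𝒦 := by
  have hle : Submodule.span ℂ (hat '' 𝒦) ≤
      Subalgebra.toSubmodule (Subalgebra.center ℂ (MonoidAlgebra ℂ G)) := by
    rw [Submodule.span_le]
    rintro _ ⟨K, hK, rfl⟩
    exact hat_mem_center hinv hK
  have hspan : (Submodule.span ℂ (hat '' 𝒦)).map centralChar =
      Subalgebra.toSubmodule (constOn 𝒳) := by
    rw [← h, Submodule.map_span, Set.image_image]
  have hmem : ∀ z, z ∈ Submodule.span ℂ (hat '' 𝒦) ↔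
      z ∈ Subalgebra.center ℂ (MonoidAlgebra ℂ G) ∧ centralChar z ∈ constOn 𝒳 := by
    intro z
    constructor
    · exact fun hz => ⟨hle hz, by
        rw [← Subalgebra.mem_toSubmodule, ← hspan]
        exact ⟨z, hz, rfl⟩⟩
    · rintro ⟨hz, hzX⟩
      rw [← Subalgebra.mem_toSubmodule, ← hspan] at hzX
      obtain ⟨w, hw, hwz⟩ := hzX
      have : w - z = 0 := eq_zero_of_centralChar_eq_zero (sub_mem (hle hw) hz) (by
        rw [map_sub, hwz, sub_self])
      rwa [← sub_eq_zero.1 this]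
  refine ⟨Submodule.toSubalgebra (Submodule.span ℂ (hat '' 𝒦)) ?_ ?_, hle,
    Submodule.toSubalgebra_toSubmodule _ _ _⟩
  · rw [hmem, centralChar_one]
    exact ⟨one_mem _, one_mem _⟩
  · intro z w hz hw
    rw [hmem] at hz hw ⊢
    rw [centralChar_mul hz.1]
    exact ⟨mul_mem hz.1 hw.1, mul_mem hz.2 hw.2⟩

theorem span_centralChar_eq_of_classSumsSpanSubalgebra (h : ClassSumsSpanSubalgebra 𝒦) :
    Submodule.span ℂ ((fun K => centralChar (hat K)) '' 𝒦) =
      Subalgebra.toSubmodule (constOn (Irpt 𝒦)) := by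
  obtain ⟨A, hAc, hA⟩ := h
  have hspan : (Subalgebra.toSubmodule A).map centralChar =
      Submodule.span ℂ ((fun K => centralChar (hat K)) '' 𝒦) := by
    rw [hA, Submodule.map_span, Set.image_image]
  refine span_eq_constOn_classes irrSetoid_iff
    (A := Submodule.toSubalgebra ((Subalgebra.toSubmodule A).map centralChar) ?_ ?_) ?_
  · exact ⟨1, A.one_mem, centralChar_one⟩
  · rintro _ _ ⟨z, hz, rfl⟩ ⟨w, hw, rfl⟩
    exact ⟨z * w, A.mul_mem hz hw, centralChar_mul (hAc hz) w⟩
  · exact (Submodule.toSubalgebra_toSubmodule _ _ _).trans hspan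

end Main

end Superchar

theorem mainTheorem2 {G : Type*} [Group G] [Finite G]
    (𝒳 : Set (Set (Superchar.Irr G))) (h𝒳 : Setoid.IsPartition 𝒳)
    (𝒦 : Set (Set G)) (h𝒦 : Setoid.IsPartition 𝒦) (hinv : Superchar.IsGInvariant 𝒦) :
    List.TFAE [
      𝒦.ncard = 𝒳.ncard ∧ 𝒦 = Superchar.Clpt 𝒳,
      𝒦.ncard = 𝒳.ncard ∧ 𝒳 = Superchar.Irpt 𝒦,
      𝒦 = Superchar.Clpt 𝒳 ∧ 𝒳 = Superchar.Irpt 𝒦,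
      Superchar.ClassSumsSpanSubalgebra 𝒦 ∧ 𝒳 = Superchar.Irpt 𝒦,
      Superchar.CharSumsSpanSubalgebra 𝒳 ∧ 𝒦 = Superchar.Clpt 𝒳,
      Superchar.IsSupercharacterTheory 𝒳 𝒦] := by
  open Superchar in
  have hdual := span_sigma_eq_iff_span_centralChar_eq h𝒳 h𝒦 hinv
  have hX := finrank_span_sigma h𝒳
  have hK := finrank_span_centralChar h𝒦 hinv
  have hX' := finrank_constOn h𝒳
  have hK' := finrank_constOn h𝒦
  have hleσ : 𝒦 = Clpt 𝒳 →
      Submodule.span ℂ (sigma '' 𝒳) ≤ Subalgebra.toSubmodule (constOn 𝒦) := fun h => by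
    have := span_le_constOn_classes (clSetoid_iff (𝒳 := 𝒳))
    rwa [h]
  have hleω : 𝒳 = Irpt 𝒦 → Submodule.span ℂ ((fun K => centralChar (hat K)) '' 𝒦) ≤
      Subalgebra.toSubmodule (constOn 𝒳) := fun h => by
    have := span_le_constOn_classes (irrSetoid_iff (𝒦 := 𝒦))
    rwa [h]
  have hcard : Submodule.span ℂ (sigma '' 𝒳) = Subalgebra.toSubmodule (constOn 𝒦) →
      𝒦.ncard = 𝒳.ncard := fun h => by rw [← hK', ← h, hX]
  have hCl : Submodule.span ℂ (sigma '' 𝒳) = Subalgebra.toSubmodule (constOn 𝒦) →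
      𝒦 = Clpt 𝒳 := eq_classes_of_span_eq h𝒦 clSetoid_iff
  have hIr : Submodule.span ℂ (sigma '' 𝒳) = Subalgebra.toSubmodule (constOn 𝒦) →
      𝒳 = Irpt 𝒦 := fun h => eq_classes_of_span_eq h𝒳 irrSetoid_iff (hdual.1 h)
  have hσ : 𝒦.ncard = 𝒳.ncard →
      Submodule.span ℂ (sigma '' 𝒳) ≤ Subalgebra.toSubmodule (constOn 𝒦) →
      Submodule.span ℂ (sigma '' 𝒳) = Subalgebra.toSubmodule (constOn 𝒦) := fun hc hle =>
    Submodule.eq_of_le_of_finrank_eq hle (by rw [hX, hK', hc])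
  refine List.tfae_of_forall
    (Submodule.span ℂ (sigma '' 𝒳) = Subalgebra.toSubmodule (constOn 𝒦)) _ ?_
  simp only [List.forall_mem_cons, List.not_mem_nil, false_imp_iff, implies_true, and_true]
  refine ⟨⟨fun h => hσ h.1 (hleσ h.2), fun h => ⟨hcard h, hCl h⟩⟩,
    ⟨fun h => hdual.2 (Submodule.eq_of_le_of_finrank_eq (hleω h.2) (by rw [hK, hX', h.1])),
      fun h => ⟨hcard h, hIr h⟩⟩,
    ⟨fun h => hσ (le_antisymm ?_ ?_) (hleσ h.1), fun h => ⟨hCl h, hIr h⟩⟩,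
    ⟨fun h => hdual.2 ?_,
      fun h => ⟨classSumsSpanSubalgebra_of_span_eq hinv (hdual.1 h), hIr h⟩⟩,
    ⟨?_, fun h => ⟨⟨constOn 𝒦, constOn_le_classFunctions h𝒦 hinv, h.symm⟩, hCl h⟩⟩,
    ⟨fun h => hσ h.card_eq.symm ?_, fun h => ⟨h𝒳, h𝒦, (hcard h).symm, ?_⟩⟩⟩
  -- Condition (c) assumes no equality of cardinalities; its two inclusions of spans give the two
  -- inequalities.
  · rw [← hK, ← hX']
    exact Submodule.finrank_mono (hleω h.2)
  · rw [← hX, ← hK']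
    exact Submodule.finrank_mono (hleσ h.1)
  · have := span_centralChar_eq_of_classSumsSpanSubalgebra h.1
    rwa [← h.2] at this
  · rintro ⟨⟨A, -, hA⟩, h⟩
    have := span_eq_constOn_classes (clSetoid_iff (𝒳 := 𝒳)) hA
    rwa [h]
  · rw [Submodule.span_le]
    rintro _ ⟨X, hX, rfl⟩
    exact h.constant X hX
  · intro X hX
    have : sigma X ∈ Submodule.span ℂ (sigma '' 𝒳) := Submodule.subset_span ⟨X, hX, rfl⟩
    rwa [h] at this
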